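/- A lattice is a free $\mathbb{Z}$-module $N$ of finite rank with a nondegenerate symmetric bilinear form $\langle\cdot,\cdot\rangle\colon N\times N\to\mathbb{Z}$; it is even if $\langle x,x\rangle\in 2\mathbb{Z}$ for all $x\in N$. Write $N^\vee=\{x\in N\otimes\mathbb{Q} : \langle x,N\rangle\subseteq\mathbb{Z}\}$ for the dual lattice, $A_N=N^\vee/N$ for the discriminant group, $q_N\colon A_N\to\mathbb{Q}/2\mathbb{Z}$, $x+N\mapsto\langle x,x\rangle+2\mathbb{Z}$, for the discriminant form of an even lattice, $O(N)$ for the group of isometries of $N$, $O(q_N)$ for the group of automorphisms of $A_N$ preserving $q_N$, and $\mathrm{pr}\colon O(N)\to O(q_N)$ for the canonical homomorphism. For a prime $p$, a supersingular K3 lattice $N$ with prime $p$ is an even lattice of rank $22$ and signature $(1,21)$ whose discriminant is $-1$ in $\mathbb{Q}^\ast/{\mathbb{Q}^\ast}^2$ and which is $p$-elementary, that is, $p\cdot A_N=0$. The Néron-Severi lattice $\mathrm{NS}(X)$ of a supersingular K3 surface $X$ over an algebraically closed field of characteristic $p\ge 3$ is a supersingular K3 lattice with prime $p$. Let $\Gamma=U\oplus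 E_8$ be the even unimodular lattice of signature $(1,9)$ (so $E_8$ is negative definite), and let $\Gamma(2)$ be $\Gamma$ with its form multiplied by $2$. Let $\mathfrak{M}$ be the set of primitive sublattices $M\subseteq N$ (that is, $N/M$ is free) such that $M\cong\Gamma(2)$ and no vector of square $-2$ in $N$ is orthogonal to $M$. **Proposition.** Let $p\ge 3$ be a prime, let $N$ be a supersingular K3 lattice with prime $p$ (for example $N=\mathrm{NS}(X)$ for a supersingular K3 surface $X$ over an algebraically closed field of characteristic $p$), let $M\in\mathfrak{M}$, and let $\psi'\colon M^\perp\to M^\perp$ be an isometry. Then: 1. there exists an isometry $\psi\in O(N)$ with $\psi|_{M^\perp}=\psi'$; 2. every $\psi\in O(N)$ with $\psi|_{M^\perp}=\psi'$ satisfies $\psi(M)=M$; 3. the image of $\psi$ in $O(q_N)$ depends only on $\psi'$: if $\psi_1,\psi_2\in O(N)$ both restrict to $\psi'$ on $M^\perp$, then $\mathrm{pr}(\psi_1)=\mathrm{pr}(\psi_2)$. -/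

import Mathlib

open scoped TensorProduct

noncomputable section

namespace K3Lattice

section Lattices

variable {N : Type*} [AddCommGroup N] (B : LinearMap.BilinForm ℤ N)

/-- `(N, B)` is an even lattice: the form `B` is symmetric, nondegenerate, and `B x x` is even for
every `x`. The underlying group is free of finite rank, which is required through the type classes
`Module.Free ℤ N` and `Module.Finite ℤ N`. -/
structure IsEvenLattice [Module.Free ℤ N] [Module.Finite ℤ N] : Prop where
  symm : ∀ x y : N, B x y = B y x
  nondegenerate : B.Nondegenerate
  even : ∀ x : N, Even (B x x)

/-- The discriminant of a lattice: the determinant of its Gram matrix in a basis. It does not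
depend on the basis, see `discriminant_eq`. -/
def discriminant [Module.Free ℤ N] [Module.Finite ℤ N] : ℤ :=
  (LinearMap.BilinForm.toMatrix (Module.finBasis ℤ N) B).det

theorem discriminant_eq [Module.Free ℤ N] [Module.Finite ℤ N]
    (b : Module.Basis (Fin (Module.finrank ℤ N)) ℤ N) :
    discriminant B = (LinearMap.BilinForm.toMatrix b B).det := by
  have h := LinearMap.BilinForm.toMatrix_mul_basis_toMatrix (b := Module.finBasis ℤ N) b B
  have hu : IsUnit ((Module.finBasis ℤ N).toMatrix b).det := by
    have := congrArg Matrix.det ((Module.finBasis ℤ N).toMatrix_mul_toMatrix_flip b)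
    rw [Matrix.det_mul, Matrix.det_one] at this
    exact IsUnit.of_mul_eq_one _ this
  rw [← h, Matrix.det_mul, Matrix.det_mul, Matrix.det_transpose, discriminant]
  rcases Int.isUnit_iff.1 hu with h1 | h1 <;> rw [h1] <;> ring

/-- The group `O(N)` of isometries of `(N, B)`. -/
def isometryGroup : Subgroup (N ≃ₗ[ℤ] N) where
  carrier := {f | ∀ x y : N, B (f x) (f y) = B x y}
  one_mem' _ _ := rfl
  mul_mem' {f g} hf hg x y := (hf (g x) (g y)).trans (hg x y)
  inv_mem' {f} hf x y := by
    have h := hf (f⁻¹ x) (f⁻¹ y)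
    have hx : ∀ z, f (f⁻¹ z) = z := fun z => f.apply_symm_apply z
    rw [hx, hx] at h
    exact h.symm

/-! ### The discriminant group and the discriminant form -/

/-- The `ℚ`-valued form on `ℚ ⊗ N`. -/
abbrev rationalForm : LinearMap.BilinForm ℚ (ℚ ⊗[ℤ] N) := B.baseChange ℚ

variable (N) in
/-- The lattice `N` inside `ℚ ⊗ N`. -/
def image : Submodule ℤ (ℚ ⊗[ℤ] N) := LinearMap.range (TensorProduct.mk ℤ ℚ N 1)

/-- The dual lattice: all `x` in `ℚ ⊗ N` that pair integrally with every element of `N`. -/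
def dual : Submodule ℤ (ℚ ⊗[ℤ] N) := (rationalForm B).dualSubmodule (image N)

theorem mem_dual_iff (x : ℚ ⊗[ℤ] N) :
    x ∈ dual B ↔ ∀ n : N, ∃ m : ℤ, (m : ℚ) = rationalForm B x (1 ⊗ₜ[ℤ] n) := by
  constructor
  · intro h n
    exact Submodule.mem_one.1 (h _ ⟨n, rfl⟩)
  · rintro h _ ⟨n, rfl⟩
    exact Submodule.mem_one.2 (h n)

/-- The discriminant group: the dual lattice modulo the lattice. -/
abbrev DiscriminantGroup : Type _ := dual B ⧸ (image N).submoduleOf (dual B)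

/-- `N` is `p`-elementary: its discriminant group is annihilated by `p`. -/
def IsElementary (p : ℕ) : Prop := ∀ a : DiscriminantGroup B, p • a = 0

variable {B}

theorem rationalForm_symm (h : ∀ x y : N, B x y = B y x) (x y : ℚ ⊗[ℤ] N) :
    rationalForm B x y = rationalForm B y x :=
  (LinearMap.BilinForm.IsSymm.baseChange ℚ ⟨h⟩).eq x y

/-- The discriminant quadratic form of an even lattice, with values in `ℚ / 2ℤ`: the class of `x`
in the dual lattice is sent to `⟨x, x⟩` modulo `2ℤ`. -/
def discriminantForm [Module.Free ℤ N] [Module.Finite ℤ N] (hB : IsEvenLattice B) :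
    DiscriminantGroup B → AddCircle (2 : ℚ) :=
  Quotient.lift (fun x : dual B => ((rationalForm B x x : ℚ) : AddCircle (2 : ℚ))) (by
    intro x y hxy
    have hxy' := (Submodule.quotientRel_def _).1 hxy
    obtain ⟨n, hn⟩ : ∃ n : N, (1 : ℚ) ⊗ₜ[ℤ] n = (x : ℚ ⊗[ℤ] N) - y := hxy'
    obtain ⟨m, hm⟩ := (mem_dual_iff B _).1 y.2 n
    obtain ⟨c, hc⟩ := hB.even n
    have hx : (x : ℚ ⊗[ℤ] N) = y + (1 : ℚ) ⊗ₜ[ℤ] n := by rw [hn]; abel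
    have hnn : rationalForm B ((1 : ℚ) ⊗ₜ[ℤ] n) ((1 : ℚ) ⊗ₜ[ℤ] n) = c + c := by
      rw [LinearMap.BilinForm.baseChange_tmul, hc]; simp
    have hny := rationalForm_symm hB.symm ((1 : ℚ) ⊗ₜ[ℤ] n) y
    change ((_ : ℚ) : AddCircle (2 : ℚ)) = ((_ : ℚ) : AddCircle (2 : ℚ))
    refine QuotientAddGroup.eq.2 (AddSubgroup.mem_zmultiples_iff.2 ⟨-(m + c), ?_⟩)
    rw [hx]
    simp only [map_add, LinearMap.add_apply, hnn, hny, ← hm]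
    rw [zsmul_eq_mul]; push_cast; ring)

/-- `ℚ ⊗ f` preserves the rational form when `f` is an isometry. -/
theorem rationalForm_lTensor {f : N ≃ₗ[ℤ] N} (hf : f ∈ isometryGroup B) (x y : ℚ ⊗[ℤ] N) :
    rationalForm B (f.lTensor ℚ x) (f.lTensor ℚ y) = rationalForm B x y := by
  induction x with
  | zero => simp
  | add x₁ x₂ h₁ h₂ => simp only [map_add, LinearMap.add_apply, h₁, h₂]
  | tmul a m =>
    induction y with
    | zero => simp
    | add y₁ y₂ h₁ h₂ => simp only [map_add, h₁, h₂]
    | tmul b n =>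
      rw [LinearEquiv.lTensor_tmul, LinearEquiv.lTensor_tmul,
        LinearMap.BilinForm.baseChange_tmul, LinearMap.BilinForm.baseChange_tmul, hf m n]

theorem lTensor_mem_dual {f : N ≃ₗ[ℤ] N} (hf : f ∈ isometryGroup B) (x : ℚ ⊗[ℤ] N)
    (hx : x ∈ dual B) : f.lTensor ℚ x ∈ dual B := by
  rw [mem_dual_iff] at hx ⊢
  intro n
  obtain ⟨m, hm⟩ := hx (f.symm n)
  refine ⟨m, ?_⟩
  rw [hm, ← rationalForm_lTensor hf, LinearEquiv.lTensor_tmul, LinearEquiv.apply_symm_apply]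

/-- The map induced by an isometry on the discriminant group. -/
def discriminantMap (f : isometryGroup B) : DiscriminantGroup B →ₗ[ℤ] DiscriminantGroup B :=
  Submodule.mapQ _ _
    ((f.1.lTensor ℚ).toLinearMap.restrict (p := dual B) (q := dual B) (lTensor_mem_dual f.2)) (by
      rintro x ⟨n, hn⟩
      refine ⟨f.1 n, ?_⟩
      change _ = f.1.lTensor ℚ (x : ℚ ⊗[ℤ] N)
      rw [← show _ = (x : ℚ ⊗[ℤ] N) from hn]
      exact (LinearEquiv.lTensor_tmul ..).symm)

theorem discriminantMap_one : discriminantMap (1 : isometryGroup B) = LinearMap.id := by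
  refine Submodule.linearMap_qext _ (LinearMap.ext fun x => ?_)
  refine congrArg (Submodule.Quotient.mk (p := (image N).submoduleOf (dual B))) (Subtype.ext ?_)
  change (LinearEquiv.refl ℤ N).lTensor ℚ (x : ℚ ⊗[ℤ] N) = x
  simp

theorem discriminantMap_mul (f g : isometryGroup B) :
    discriminantMap (f * g) = discriminantMap f ∘ₗ discriminantMap g := by
  refine Submodule.linearMap_qext _ (LinearMap.ext fun x => ?_)
  refine congrArg (Submodule.Quotient.mk (p := (image N).submoduleOf (dual B))) (Subtype.ext ?_)
  change (g.1.trans f.1).lTensor ℚ (x : ℚ ⊗[ℤ] N) = f.1.lTensor ℚ (g.1.lTensor ℚ x)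
  simp [LinearEquiv.lTensor_trans]

/-- The orthogonal group `O(q_N)`: automorphisms of the discriminant group that preserve the
discriminant form. -/
def discriminantOrthogonalGroup [Module.Free ℤ N] [Module.Finite ℤ N] (hB : IsEvenLattice B) :
    Subgroup (DiscriminantGroup B ≃ₗ[ℤ] DiscriminantGroup B) where
  carrier := {α | ∀ a, discriminantForm hB (α a) = discriminantForm hB a}
  one_mem' _ := rfl
  mul_mem' {α β} hα hβ a := (hα (β a)).trans (hβ a)
  inv_mem' {α} hα a := by
    have h := hα (α⁻¹ a)
    have ha : α (α⁻¹ a) = a := α.apply_symm_apply a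
    rw [ha] at h
    exact h.symm

/-- The canonical homomorphism `O(N) → O(q_N)`. -/
def discriminantRepresentation [Module.Free ℤ N] [Module.Finite ℤ N] (hB : IsEvenLattice B) :
    isometryGroup B →* discriminantOrthogonalGroup hB where
  toFun f := ⟨LinearEquiv.ofLinearMap (discriminantMap f) (discriminantMap f⁻¹)
      (by rw [← discriminantMap_mul, mul_inv_cancel, discriminantMap_one])
      (by rw [← discriminantMap_mul, inv_mul_cancel, discriminantMap_one]), by
    intro a
    obtain ⟨x, rfl⟩ := Submodule.Quotient.mk_surjective _ a
    exact congrArg (fun t : ℚ => (t : AddCircle (2 : ℚ))) (rationalForm_lTensor f.2 x x)⟩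
  map_one' := Subtype.ext (LinearEquiv.toLinearMap_injective discriminantMap_one)
  map_mul' f g := Subtype.ext (LinearEquiv.toLinearMap_injective (discriminantMap_mul f g))

/-! ### Supersingular K3 lattices -/

variable (B) in
/-- `(N, B)` is a supersingular K3 lattice with associated prime `p`: an even lattice of rank 22
and signature `(1, 21)`, whose discriminant is `-1` in `ℚˣ / (ℚˣ)²` and which is `p`-elementary. -/
structure IsSupersingularK3Lattice [Module.Free ℤ N] [Module.Finite ℤ N] (p : ℕ) : Prop where
  isEvenLattice : IsEvenLattice B
  rank : Module.finrank ℤ N = 22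
  discriminant_class : ∃ r : ℚ, r ≠ 0 ∧ (discriminant B : ℚ) = -1 * r ^ 2
  signature_pos : sigPos (rationalForm B).toQuadraticMap = 1
  signature_neg : sigNeg (rationalForm B).toQuadraticMap = 21
  elementary : IsElementary B p

/-- The Gram matrix of the lattice `Γ = U ⊕ E₈`, the even unimodular lattice of signature
`(1, 9)`; here `E₈` is negative definite. -/
def gammaMatrix : Matrix (Fin 2 ⊕ Fin 8) (Fin 2 ⊕ Fin 8) ℤ :=
  Matrix.fromBlocks !![0, 1; 1, 0] 0 0 (-CartanMatrix.E₈)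

/-- The form of the lattice `Γ(2)` on `ℤ^10`. -/
def gammaTwo : LinearMap.BilinForm ℤ (Fin 2 ⊕ Fin 8 → ℤ) :=
  (2 : ℤ) • Matrix.toBilin' gammaMatrix

variable (B) in
/-- The set `𝔐` of primitive sublattices `M` of `N` that are isometric to `Γ(2)` and such that no
vector of square `-2` is orthogonal to `M`. -/
def enriquesSublattices : Set (Submodule ℤ N) :=
  {M | Module.Free ℤ (N ⧸ M) ∧
    (∃ e : (Fin 2 ⊕ Fin 8 → ℤ) ≃ₗ[ℤ] M, ∀ x y, B (e x) (e y) = gammaTwo x y) ∧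
    ∀ v ∈ B.orthogonal M, B v v ≠ -2}

end Lattices

end K3Lattice

end

/-! Write `K` for the orthogonal complement of `M`. The discriminant group of `M ≅ Γ(2)` is `Γ/2Γ`,
while that of `N` is killed by the odd prime `p`. Hence `2N ⊆ M ⊕ K`, and `N` is obtained from `M ⊕
K` by gluing all of `Γ/2Γ` to the 2-torsion of the discriminant group of `K`
(`isFullGluing_of_mem_enriquesSublattices`).

Existence: an isometry of `K` acts on that 2-torsion, hence through the gluing on `Γ/2Γ`, where it
preserves `⟨x, x⟩ / 2` mod 2 because `N` is even. It extends to `N` as soon as this action lifts to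
`O(Γ)`. Every such action lifts (`exists_isometry_lift`): the orthogonal group over `𝔽₂` is
generated by transvections (`isometry_mem_of_transvection_mem`), and each transvection is the
reduction of a reflection in a vector of square `±2`.

Stability of `M`: an extension preserves `K`, and `M` is the orthogonal complement of `K`.

Uniqueness on the discriminant group: `M` contributes only at 2 and the discriminant group of `N`
lives at `p`, so its classes are controlled by `K` alone (`exists_sub_eq_smul`). -/

noncomputable section

namespace K3Lattice

/-! ### Generation of orthogonal groups over `𝔽₂` by transvections. -/

section QuadraticSpaceModTwo

variable {V : Type*} [AddCommGroup V] [Module (ZMod 2) V]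

theorem polar_self_eq_zero {b : LinearMap.BilinForm (ZMod 2) V} {q : V → ZMod 2}
    (hq : ∀ x y, q (x + y) = q x + q y + b x y) (x : V) : b x x = 0 := by
  have h0 : q 0 = 0 := by simpa using hq 0 0
  have h := hq x x
  rw [ZModModule.add_self, h0, CharTwo.add_self_eq_zero, zero_add] at h
  exact h.symm

theorem polar_comm {b : LinearMap.BilinForm (ZMod 2) V} {q : V → ZMod 2}
    (hq : ∀ x y, q (x + y) = q x + q y + b x y) (x y : V) : b x y = b y x := by
  have h := hq x y
  rw [add_comm x y, hq y x, add_comm (q y)] at h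
  exact (add_left_cancel h).symm

theorem exists_mem_subgroup_transvection {b : LinearMap.BilinForm (ZMod 2) V} {q : V → ZMod 2}
    (hq : ∀ x y, q (x + y) = q x + q y + b x y) {H : Subgroup (V ≃ₗ[ZMod 2] V)}
    (hH : ∀ (v : V) (t : V ≃ₗ[ZMod 2] V), q v = 1 → (∀ x, t x = x + b v x • v) → t ∈ H)
    {v : V} (hv : q v = 1) : ∃ t ∈ H, ∀ x, t x = x + b v x • v := by
  let t := LinearEquiv.transvection (polar_self_eq_zero hq v)
  exact ⟨t, hH v t hv fun _ => rfl, fun _ => rfl⟩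

theorem polar_transvection {b : LinearMap.BilinForm (ZMod 2) V} {q : V → ZMod 2}
    (hq : ∀ x y, q (x + y) = q x + q y + b x y) {v : V} (hv : q v = 1) (x : V) :
    q (x + b v x • v) = q x := by
  have h2 : ∀ c : ZMod 2, c = 0 ∨ c = 1 := by decide
  rcases h2 (b v x) with h | h
  · simp [h]
  · rw [h, one_smul, hq, hv, polar_comm hq, h, add_assoc, CharTwo.add_self_eq_zero, add_zero]

/-- The product of the transvections in `v` and `v + e`, for `e` orthogonal to `v`. -/
theorem transvection_transvection {b : LinearMap.BilinForm (ZMod 2) V} {q : V → ZMod 2}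
    (hq : ∀ x y, q (x + y) = q x + q y + b x y) {v e : V} (hve : b v e = 0) (z : V) :
    (z + b (v + e) z • (v + e)) + b v (z + b (v + e) z • (v + e)) • v =
      z + b v z • e + b e z • v + b e z • e := by
  have hvv := polar_self_eq_zero hq v
  simp only [map_add, LinearMap.add_apply, map_smul, hve, hvv, add_zero, smul_zero]
  have h := ZModModule.add_self (b v z • v)
  linear_combination (norm := module) h

/-- In a nondegenerate quadratic space over `𝔽₂` of dimension at least `5`, the orthogonal
complement of two orthogonal vectors is not totally singular. -/
theorem exists_orthogonal_eq_one [Finite V] {b : LinearMap.BilinForm (ZMod 2) V} {q : V → ZMod 2}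
    (hq : ∀ x y, q (x + y) = q x + q y + b x y) (hb : b.Nondegenerate)
    (hdim : 5 ≤ Module.finrank (ZMod 2) V) (e a : V) :
    ∃ v, q v = 1 ∧ b v e = 0 ∧ b v a = 0 := by
  by_contra! hcon
  let W := Submodule.span (ZMod 2) ({e, a} : Set V)
  have hW : Module.finrank (ZMod 2) W ≤ 2 := by
    classical
    have h := finrank_span_finset_le_card (R := ZMod 2) ({e, a} : Finset V)
    simp only [Finset.coe_insert, Finset.coe_singleton] at h
    exact h.trans Finset.card_le_two
  have hrefl : b.IsRefl := fun x y h => by rw [polar_comm hq, h]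
  have hmem : ∀ x ∈ b.orthogonal W, b x e = 0 ∧ b x a = 0 := fun x hx =>
    ⟨hrefl _ _ (hx e (Submodule.subset_span (by simp))),
      hrefl _ _ (hx a (Submodule.subset_span (by simp)))⟩
  have h2 : ∀ c : ZMod 2, c ≠ 1 → c = 0 := by decide
  have hz : ∀ x ∈ b.orthogonal W, q x = 0 := fun x hx =>
    h2 _ fun h => hcon x h (hmem x hx).1 (hmem x hx).2
  -- A totally singular complement of `W` would lie in its own complement, which is `W`; but it has
  -- dimension at least `5 - 2 = 3`.
  have hle : b.orthogonal W ≤ b.orthogonal (b.orthogonal W) := by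
    intro x hx y hy
    have h := hq y x
    rw [hz _ (add_mem hy hx), hz _ hx, hz _ hy, zero_add, zero_add] at h
    exact h.symm
  rw [LinearMap.BilinForm.orthogonal_orthogonal hb hrefl] at hle
  have h1 := Submodule.finrank_mono hle
  have h3 := LinearMap.BilinForm.finrank_orthogonal hb W
  omega

/-- Over `𝔽₂`, a subgroup that contains all transvections of a nondegenerate quadratic space of
dimension at least `5` contains all of its isometries. -/
theorem isometry_mem_of_transvection_mem [Finite V] {b : LinearMap.BilinForm (ZMod 2) V}
    {q : V → ZMod 2} (hq : ∀ x y, q (x + y) = q x + q y + b x y) (hb : b.Nondegenerate)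
    (hdim : 5 ≤ Module.finrank (ZMod 2) V) {H : Subgroup (V ≃ₗ[ZMod 2] V)}
    (hH : ∀ (v : V) (t : V ≃ₗ[ZMod 2] V), q v = 1 → (∀ x, t x = x + b v x • v) → t ∈ H)
    (g : V ≃ₗ[ZMod 2] V) (hg : ∀ x, q (g x) = q x) : g ∈ H := by
  -- Descent on the number of moved vectors: compose `g` with some `t ∈ H` that keeps the fixed
  -- vectors of `g` and brings one moved vector back.
  induction hn : {x | g x ≠ x}.ncard using Nat.strong_induction_on generalizing g with
  | _ n ih =>
  have hbg : ∀ x y, b (g x) (g y) = b x y := fun x y => by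
    have h := hq (g x) (g y)
    rw [← map_add, hg, hg, hg, hq] at h
    exact (add_left_cancel h).symm
  have step : ∀ t ∈ H, (∀ x, q (t x) = q x) → (∀ x, g x = x → t x = x) →
      (∃ x, g x ≠ x ∧ t (g x) = x) → g ∈ H := by
    rintro t ht hqt hfix ⟨x, hx, htx⟩
    have h : t * g ∈ H := by
      refine ih _ ?_ (t * g) (fun y => (hqt _).trans (hg y)) rfl
      rw [← hn]
      refine Set.ncard_lt_ncard ⟨fun y hy hgy => hy ?_, fun hsub => hsub hx htx⟩ (Set.toFinite _)
      exact (congrArg t hgy).trans (hfix y hgy)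
    exact (Subgroup.mul_mem_cancel_left H ht).1 h
  have hfixo : ∀ x y, g y = y → b (g x + x) y = 0 := fun x y hy => by
    have h := hbg x y
    rw [hy] at h
    rw [map_add, LinearMap.add_apply, h, CharTwo.add_self_eq_zero]
  have hqd : ∀ x, q (g x + x) = b (g x) x := fun x => by
    rw [hq, hg, CharTwo.add_self_eq_zero, zero_add]
  have hself := polar_self_eq_zero hq
  -- If `g x + x` is nonsingular, its transvection sends `g x` to `x`; it keeps the fixed vectors of
  -- `g`, as these are orthogonal to `g x + x`.
  by_cases h1 : ∃ x, q (g x + x) = 1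
  · obtain ⟨x, hx⟩ := h1
    obtain ⟨t, ht, htf⟩ := exists_mem_subgroup_transvection hq hH hx
    refine step t ht (fun y => ?_) (fun y hy => ?_) ⟨x, fun h => ?_, ?_⟩
    · rw [htf, polar_transvection hq hx]
    · rw [htf, hfixo x y hy, zero_smul, add_zero]
    · rw [h, ZModModule.add_self] at hx
      have h0 : q 0 = 0 := by simpa using hq 0 0
      rw [h0] at hx
      exact zero_ne_one hx
    · have hbx : b (g x + x) (g x) = 1 := by
        rw [map_add, LinearMap.add_apply, hself, zero_add, polar_comm hq, ← hqd, hx]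
      rw [htf, hbx, one_smul, ← add_assoc, ZModModule.add_self, zero_add]
  by_cases hid : ∀ x, g x = x
  · have : g = 1 := LinearEquiv.ext hid
    rw [this]
    exact one_mem H
  obtain ⟨x, hx⟩ := not_forall.1 hid
  have h2 : ∀ c : ZMod 2, c ≠ 1 → c = 0 := by decide
  have h2' : ∀ c : ZMod 2, c ≠ 0 → c = 1 := by decide
  -- Otherwise the image of `g + 1` is totally singular and no single transvection of this kind is
  -- available. Four transvections, in `v`, `v + e`, `v + a` and `v + a + e`, are combined into the
  -- map `z ↦ z + b a z • e + b e z • a`, which sends `g x = x + e` to `x`.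
  have hz : ∀ y, q (g y + y) = 0 := fun y => h2 _ fun h => h1 ⟨y, h⟩
  have hw : ∀ y z, b (g y + y) (g z + z) = 0 := fun y z => by
    have h := hq (g y + y) (g z + z)
    have h' := hz (y + z)
    rw [map_add, add_add_add_comm, h, hz, hz, zero_add, zero_add] at h'
    exact h'
  obtain ⟨y, hy⟩ : ∃ y, b (g x + x) y ≠ 0 := by
    by_contra! hcon
    have h : g x + x = 0 := hb.1 _ hcon
    exact hx (by rw [← add_left_inj x, h, ZModModule.add_self])
  have hy1 := h2' _ hy
  obtain ⟨v, hv, hve, hva⟩ := exists_orthogonal_eq_one hq hb hdim (g x + x) (g y + y)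
  set e := g x + x with he
  set a := g y + y with ha
  have hea : b e a = 0 := hw x y
  have hax : b a x = 1 := by
    have h := hz (x + y)
    have e1 := hz x
    have e2 := hz y
    rw [hqd] at h e1 e2
    simp only [map_add, LinearMap.add_apply, e1, e2, zero_add, add_zero] at h
    have h3 : b (g x) y + b x y = 1 := by
      rw [← LinearMap.add_apply, ← map_add]; exact hy1
    rw [ha, map_add, LinearMap.add_apply, polar_comm hq y x]
    linear_combination h + h3 - CharTwo.add_self_eq_zero (b (g x) y)
  have hqve : q (v + e) = 1 := by rw [hq, hv, hz, hve, add_zero, add_zero]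
  have hqva : q (v + a) = 1 := by rw [hq, hv, hz, hva, add_zero, add_zero]
  have hvae : b (v + a) e = 0 := by
    rw [polar_comm hq, (b e).map_add, polar_comm hq e v, hve, hea, add_zero]
  have hqvae : q (v + a + e) = 1 := by rw [hq (v + a), hqva, hz, hvae, add_zero, add_zero]
  obtain ⟨t₁, ht₁, hf₁⟩ := exists_mem_subgroup_transvection hq hH hv
  obtain ⟨t₂, ht₂, hf₂⟩ := exists_mem_subgroup_transvection hq hH hqve
  obtain ⟨t₃, ht₃, hf₃⟩ := exists_mem_subgroup_transvection hq hH hqva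
  obtain ⟨t₄, ht₄, hf₄⟩ := exists_mem_subgroup_transvection hq hH hqvae
  have hE : ∀ z, t₁ (t₂ (t₃ (t₄ z))) = z + b a z • e + b e z • a := fun z => by
    rw [hf₄, hf₃, transvection_transvection hq hvae, hf₂, hf₁, transvection_transvection hq hve]
    have hee := hself e
    have hev : b e v = 0 := by rw [polar_comm hq, hve]
    simp only [map_add, LinearMap.add_apply, map_smul, hve, hva, hee, hea, hev, hself v,
      smul_zero, add_zero]
    have h3 := ZModModule.add_self (b v z • e)
    have h4 := ZModModule.add_self (b e z • e)
    have h5 := ZModModule.add_self (b e z • v)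
    linear_combination (norm := module) h3 + h4 + h5
  refine step (t₁ * t₂ * t₃ * t₄) (mul_mem (mul_mem (mul_mem ht₁ ht₂) ht₃) ht₄) (fun z => ?_)
    (fun z hgz => ?_) ⟨x, hx, ?_⟩
  · change q (t₁ (t₂ (t₃ (t₄ z)))) = q z
    rw [hf₁, polar_transvection hq hv, hf₂, polar_transvection hq hqve, hf₃,
      polar_transvection hq hqva, hf₄, polar_transvection hq hqvae]
  · refine (hE z).trans ?_
    rw [hfixo x z hgz, hfixo y z hgz, zero_smul, zero_smul, add_zero, add_zero]
  · refine (hE (g x)).trans ?_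
    have hgx : g x = x + e := by
      rw [he, add_comm, add_assoc, ZModModule.add_self, add_zero]
    have hae : b a e = 0 := by rw [polar_comm hq, hea]
    have hex : b e x = 0 := by
      rw [he, map_add, LinearMap.add_apply, hself, add_zero, ← hqd]; exact hz x
    rw [hgx, (b a).map_add, (b e).map_add, hax, hae, hex, hself, add_zero, add_zero, one_smul, zero_smul,
      add_zero, add_assoc, ZModModule.add_self, add_zero]

end QuadraticSpaceModTwo

/-! ### The lattice `Γ`, its reduction modulo 2, and lifting of isometries. -/

section Gamma

/-- The form of the lattice `Γ` on `ℤ^10`. -/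
abbrev gammaForm : LinearMap.BilinForm ℤ (Fin 2 ⊕ Fin 8 → ℤ) := Matrix.toBilin' gammaMatrix

/-- The negative definite `E₈`-form on `ℤ^8`. -/
abbrev negE8Form : LinearMap.BilinForm ℤ (Fin 8 → ℤ) := Matrix.toBilin' (-CartanMatrix.E₈)

theorem gammaMatrix_isSymm : gammaMatrix.IsSymm := by
  rw [gammaMatrix, Matrix.isSymm_fromBlocks_iff]
  refine ⟨by decide, by simp, by simp, ?_⟩
  rw [Matrix.IsSymm, Matrix.transpose_neg, CartanMatrix.E₈_transpose]

theorem gammaMatrix_det : gammaMatrix.det = -1 := by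
  rw [gammaMatrix, Matrix.det_fromBlocks_zero₂₁, Matrix.det_neg, CartanMatrix.E₈_det]
  simp

theorem gammaForm_symm (x y : Fin 2 ⊕ Fin 8 → ℤ) : gammaForm x y = gammaForm y x := by
  rw [Matrix.toBilin'_apply', Matrix.toBilin'_apply', Matrix.dotProduct_mulVec,
    dotProduct_comm, ← Matrix.mulVec_transpose, gammaMatrix_isSymm]

theorem gammaForm_apply (x y : Fin 2 ⊕ Fin 8 → ℤ) :
    gammaForm x y = x (Sum.inl 0) * y (Sum.inl 1) + x (Sum.inl 1) * y (Sum.inl 0) +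
      negE8Form (x ∘ Sum.inr) (y ∘ Sum.inr) := by
  simp [Matrix.toBilin'_apply, gammaMatrix, Fintype.sum_sum_type, Fin.sum_univ_two]

theorem negE8Form_even (w : Fin 8 → ℤ) : Even (negE8Form w w) := by
  refine ⟨-(w 0 ^ 2 + w 1 ^ 2 + w 2 ^ 2 + w 3 ^ 2 + w 4 ^ 2 + w 5 ^ 2 + w 6 ^ 2 + w 7 ^ 2) +
    (w 0 * w 2 + w 1 * w 3 + w 2 * w 3 + w 3 * w 4 + w 4 * w 5 + w 5 * w 6 + w 6 * w 7), ?_⟩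
  simp [Matrix.toBilin'_apply, Fin.sum_univ_eight, CartanMatrix.E₈]
  ring

theorem gammaForm_even (x : Fin 2 ⊕ Fin 8 → ℤ) : Even (gammaForm x x) := by
  obtain ⟨c, hc⟩ := negE8Form_even (x ∘ Sum.inr)
  exact ⟨x (Sum.inl 0) * x (Sum.inl 1) + c, by rw [gammaForm_apply, hc]; ring⟩

/-- `Γ` is unimodular. -/
theorem exists_gammaForm_eq (φ : (Fin 2 ⊕ Fin 8 → ℤ) →ₗ[ℤ] ℤ) :
    ∃ x, ∀ y, gammaForm x y = φ y := by
  have hu : IsUnit gammaMatrix.det := by rw [gammaMatrix_det]; simp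
  refine ⟨Matrix.vecMul (fun i => φ (Pi.single i 1)) gammaMatrix⁻¹, fun y => ?_⟩
  rw [Matrix.toBilin'_apply', Matrix.dotProduct_mulVec, Matrix.vecMul_vecMul,
    Matrix.nonsing_inv_mul _ hu, Matrix.vecMul_one]
  conv_rhs => rw [pi_eq_sum_univ' y, map_sum]
  simp only [map_smul, smul_eq_mul, dotProduct]
  refine Finset.sum_congr rfl fun i _ => ?_
  rw [mul_comm]

/-- Every class of `Γ / 2Γ` on which the quadratic form does not vanish contains a vector of
square `2` or `-2`. -/
theorem exists_gammaForm_self_eq_two (x : Fin 2 ⊕ Fin 8 → ℤ) {c : ℤ} (hc : gammaForm x x = 2 * c)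
    (hodd : Odd c) :
    ∃ r z : Fin 2 ⊕ Fin 8 → ℤ, ∃ ε : ℤ, ε * ε = 1 ∧ r = x + (2 : ℤ) • z ∧
      gammaForm r r = 2 * ε := by
  -- Only the `U`-coordinates need to move: shifting them by `2s` and `2t` changes the square as
  -- displayed.
  have hred : (∃ s t ε : ℤ, ε * ε = 1 ∧ gammaForm x x + 4 * (s * x (Sum.inl 1) +
      t * x (Sum.inl 0)) + 8 * s * t = 2 * ε) → ∃ r z : Fin 2 ⊕ Fin 8 → ℤ, ∃ ε : ℤ,
      ε * ε = 1 ∧ r = x + (2 : ℤ) • z ∧ gammaForm r r = 2 * ε := by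
    rintro ⟨s, t, ε, hε, h⟩
    refine ⟨_, Sum.elim ![s, t] 0, ε, hε, rfl, ?_⟩
    have hw : (x + (2 : ℤ) • Sum.elim ![s, t] 0) ∘ Sum.inr = x ∘ Sum.inr := by
      ext i; simp
    rw [← h, gammaForm_apply, gammaForm_apply, hw]
    simp
    ring
  apply hred
  -- If a `U`-coordinate is odd, shift it to `1`; the other one then moves the square in steps of
  -- `4`, reaching `2`. If both are even, shift the first to `2`; the steps are then `8`, and the
  -- parity of `d` decides between `2` and `-2`.
  obtain ⟨d, hd⟩ := hodd
  rcases Int.even_or_odd' (x (Sum.inl 0)) with ⟨a, ha | ha⟩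
  · rcases Int.even_or_odd' (x (Sum.inl 1)) with ⟨b, hb | hb⟩
    · rcases Int.even_or_odd' d with ⟨k, hk | hk⟩
      · exact ⟨1 - a, a * b - k - b, 1, rfl, by
          rw [hc, hd, ha, hb]; linear_combination 4 * hk⟩
      · exact ⟨1 - a, a * b - k - 1 - b, -1, rfl, by
          rw [hc, hd, ha, hb]; linear_combination 4 * hk⟩
    · exact ⟨x (Sum.inl 0) * b - d, -b, 1, rfl, by rw [hc, hd, hb]; ring⟩
  · exact ⟨-a, x (Sum.inl 1) * a - d, 1, rfl, by rw [hc, hd, ha]; ring⟩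

/-- Reduction modulo `2` on `Γ`. -/
def modTwo : (Fin 2 ⊕ Fin 8 → ℤ) →+ (Fin 2 ⊕ Fin 8 → ZMod 2) :=
  (Int.castAddHom (ZMod 2)).compLeft _

theorem modTwo_apply (x : Fin 2 ⊕ Fin 8 → ℤ) (i : Fin 2 ⊕ Fin 8) : modTwo x i = (x i : ZMod 2) :=
  rfl

theorem modTwo_surjective : Function.Surjective modTwo :=
  (ZMod.intCast_surjective (n := 2)).comp_left

theorem modTwo_eq_iff {x y : Fin 2 ⊕ Fin 8 → ℤ} :
    modTwo x = modTwo y ↔ ∃ z, x = y + (2 : ℤ) • z := by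
  constructor
  · intro h
    have h' : ∀ i, ∃ c, x i = y i + 2 * c := fun i => by
      have hi := congrFun h i
      rw [modTwo_apply, modTwo_apply, eq_comm, ZMod.intCast_eq_intCast_iff_dvd_sub] at hi
      obtain ⟨c, hc⟩ := hi
      exact ⟨c, by push_cast at hc; linarith⟩
    choose z hz using h'
    exact ⟨z, funext fun i => by simp [hz]⟩
  · rintro ⟨z, rfl⟩
    funext i
    simp only [modTwo_apply, Pi.add_apply, Pi.smul_apply, smul_eq_mul]
    push_cast
    rw [show (2 : ZMod 2) = 0 from rfl, zero_mul, add_zero]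

theorem modTwo_smul (c : ℤ) (x : Fin 2 ⊕ Fin 8 → ℤ) :
    modTwo (c • x) = (c : ZMod 2) • modTwo x := by
  funext i
  simp [modTwo_apply]

/-- The bilinear form of `Γ` reduced modulo `2`. -/
def gammaModTwo : LinearMap.BilinForm (ZMod 2) (Fin 2 ⊕ Fin 8 → ZMod 2) :=
  Matrix.toBilin' (gammaMatrix.map (Int.castRingHom (ZMod 2)))

theorem gammaModTwo_modTwo (x y : Fin 2 ⊕ Fin 8 → ℤ) :
    gammaModTwo (modTwo x) (modTwo y) = (gammaForm x y : ZMod 2) := by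
  simp [gammaModTwo, Matrix.toBilin'_apply, modTwo_apply]

theorem gammaModTwo_nondegenerate : gammaModTwo.Nondegenerate := by
  apply LinearMap.BilinForm.nondegenerate_toBilin'_of_det_ne_zero'
  rw [← RingHom.mapMatrix_apply, ← RingHom.map_det, gammaMatrix_det]
  decide

/-- The quadratic form `x ↦ ⟨x, x⟩ / 2` on `Γ / 2Γ`. -/
def gammaQuadModTwo (v : Fin 2 ⊕ Fin 8 → ZMod 2) : ZMod 2 :=
  ((gammaForm (Function.surjInv modTwo_surjective v)
    (Function.surjInv modTwo_surjective v) / 2 : ℤ) : ZMod 2)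

theorem gammaQuadModTwo_modTwo {x : Fin 2 ⊕ Fin 8 → ℤ} {c : ℤ} (hc : gammaForm x x = 2 * c) :
    gammaQuadModTwo (modTwo x) = (c : ZMod 2) := by
  obtain ⟨z, hz⟩ := modTwo_eq_iff.1 (Function.surjInv_eq modTwo_surjective (modTwo x))
  rw [gammaQuadModTwo, hz]
  obtain ⟨d, hd⟩ := gammaForm_even z
  have h : gammaForm (x + (2 : ℤ) • z) (x + (2 : ℤ) • z) =
      2 * (c + 2 * (gammaForm x z + 2 * d)) := by
    have hs := gammaForm_symm z x
    simp only [map_add, map_smul, LinearMap.add_apply, LinearMap.smul_apply, smul_eq_mul, hc, hd,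
      hs]
    ring
  rw [h, Int.mul_ediv_cancel_left _ two_ne_zero]
  push_cast
  rw [show (2 : ZMod 2) = 0 from rfl, zero_mul, add_zero]

theorem gammaQuadModTwo_add (v w : Fin 2 ⊕ Fin 8 → ZMod 2) :
    gammaQuadModTwo (v + w) = gammaQuadModTwo v + gammaQuadModTwo w + gammaModTwo v w := by
  obtain ⟨x, rfl⟩ := modTwo_surjective v
  obtain ⟨y, rfl⟩ := modTwo_surjective w
  obtain ⟨c, hc⟩ := gammaForm_even x
  obtain ⟨d, hd⟩ := gammaForm_even y
  rw [← two_mul] at hc hd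
  have h : gammaForm (x + y) (x + y) = 2 * (c + d + gammaForm x y) := by
    simp only [map_add, LinearMap.add_apply, hc, hd, gammaForm_symm y x]
    ring
  rw [← map_add, gammaQuadModTwo_modTwo h, gammaQuadModTwo_modTwo hc, gammaQuadModTwo_modTwo hd,
    gammaModTwo_modTwo]
  push_cast
  rfl

/-- The linear automorphisms of `Γ / 2Γ` that lift to isometries of `Γ`. -/
def liftableSubgroup :
    Subgroup ((Fin 2 ⊕ Fin 8 → ZMod 2) ≃ₗ[ZMod 2] (Fin 2 ⊕ Fin 8 → ZMod 2)) where
  carrier := {g | ∃ f ∈ isometryGroup gammaForm, ∀ x, modTwo (f x) = g (modTwo x)}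
  one_mem' := ⟨1, one_mem _, fun _ => rfl⟩
  mul_mem' := by
    rintro g g' ⟨f, hf, h⟩ ⟨f', hf', h'⟩
    exact ⟨f * f', mul_mem hf hf', fun x => (h _).trans (congrArg g (h' x))⟩
  inv_mem' := by
    rintro g ⟨f, hf, h⟩
    refine ⟨f⁻¹, inv_mem hf, fun x => g.injective ?_⟩
    rw [← h]
    exact (congrArg modTwo (f.apply_symm_apply x)).trans (g.apply_symm_apply _).symm

/-- The reflection of `Γ` in a vector of square `2ε = ±2`. -/
theorem exists_reflection {r : Fin 2 ⊕ Fin 8 → ℤ} {ε : ℤ} (hε : ε * ε = 1)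
    (hr : gammaForm r r = 2 * ε) :
    ∃ f ∈ isometryGroup gammaForm, ∀ x, f x = x - (ε * gammaForm r x) • r := by
  let s : (Fin 2 ⊕ Fin 8 → ℤ) →ₗ[ℤ] (Fin 2 ⊕ Fin 8 → ℤ) :=
    LinearMap.id - ε • (gammaForm r).smulRight r
  have hs : ∀ x, s x = x - (ε * gammaForm r x) • r := fun x => by
    simp [s, mul_smul]
  have hinv : Function.Involutive s := fun x => by
    have h : gammaForm r (s x) = -gammaForm r x := by
      rw [hs, map_sub, map_smul, hr, smul_eq_mul]
      linear_combination (-2 * gammaForm r x) * hε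
    rw [hs (s x), h, hs x]
    module
  refine ⟨LinearEquiv.ofInvolutive s hinv, fun x y => ?_, hs⟩
  change gammaForm (s x) (s y) = _
  rw [hs, hs]
  simp only [map_sub, map_smul, LinearMap.sub_apply, LinearMap.smul_apply, smul_eq_mul, hr,
    gammaForm_symm x r]
  linear_combination (2 * ε * gammaForm r x * gammaForm r y) * hε

/-- `O(Γ) → O(Γ / 2Γ)` is surjective. -/
theorem exists_isometry_lift
    (g : (Fin 2 ⊕ Fin 8 → ZMod 2) ≃ₗ[ZMod 2] (Fin 2 ⊕ Fin 8 → ZMod 2))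
    (hg : ∀ v, gammaQuadModTwo (g v) = gammaQuadModTwo v) :
    ∃ f ∈ isometryGroup gammaForm, ∀ x, modTwo (f x) = g (modTwo x) := by
  refine isometry_mem_of_transvection_mem (H := liftableSubgroup) gammaQuadModTwo_add
    gammaModTwo_nondegenerate (by simp) ?_ g hg
  intro v t hv ht
  obtain ⟨x, rfl⟩ := modTwo_surjective v
  obtain ⟨c, hc⟩ := gammaForm_even x
  rw [← two_mul] at hc
  rw [gammaQuadModTwo_modTwo hc, ZMod.intCast_eq_one_iff_odd] at hv
  -- As `ε` is odd, the reflection in `r` reduces modulo 2 to the transvection in the class of `r`,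
  -- which is that of `x`.
  obtain ⟨r, z, ε, hε, hrz, hr⟩ := exists_gammaForm_self_eq_two x hc hv
  obtain ⟨f, hf, hfr⟩ := exists_reflection hε hr
  refine ⟨f, hf, fun y => ?_⟩
  have hrx : modTwo r = modTwo x := modTwo_eq_iff.2 ⟨z, hrz⟩
  have hε' : (ε : ZMod 2) = 1 := by
    rw [ZMod.intCast_eq_one_iff_odd]
    exact (Int.odd_mul.1 (by rw [hε]; exact odd_one)).1
  rw [hfr, ht, map_sub, modTwo_smul, Int.cast_mul, hε', one_mul, ← gammaModTwo_modTwo, hrx,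
    ZModModule.sub_eq_add]

end Gamma

/-! ### Gluing `Γ(2)` to its orthogonal complement and extending isometries. -/

section Gluing

variable {N : Type*} [AddCommGroup N]

/-- `ι` identifies `Γ(2)` with a sublattice `M` of the even lattice `(N, B)` that is saturated at `2`,
and the discriminant group of `M` is glued entirely, along the `2`-part, to that of its orthogonal
complement. -/
structure IsFullGluing (B : LinearMap.BilinForm ℤ N) (M : Submodule ℤ N)
    (ι : (Fin 2 ⊕ Fin 8 → ℤ) →ₗ[ℤ] N) : Prop where
  symm : ∀ x y, B x y = B y x
  even : ∀ x, Even (B x x)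
  mem_iff : ∀ m, m ∈ M ↔ ∃ x, ι x = m
  form : ∀ x y, B (ι x) (ι y) = 2 * gammaForm x y
  torsion : ∀ x y : N, (2 : ℤ) • x = (2 : ℤ) • y → x = y
  saturated : ∀ n, (2 : ℤ) • n ∈ M → n ∈ M
  decomp : ∀ n, ∃ x, ∃ k : B.orthogonal M, ι x + k = (2 : ℤ) • n
  glue_left : ∀ x, ∃ k : B.orthogonal M, ∃ n, ι x + k = (2 : ℤ) • n
  glue_right : ∀ k : B.orthogonal M, (∀ l : B.orthogonal M, Even (B k l)) →
    ∃ x n, ι x + k = (2 : ℤ) • n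

/-- Write `2n = m + k`. Then `k` is orthogonal to `M` and, like `n`, to the complement, hence to
`2N`; so `k = 0`, and saturation gives `n ∈ M`. -/
theorem mem_of_orthogonal_orthogonal {B : LinearMap.BilinForm ℤ N} {M : Submodule ℤ N}
    (hsymm : ∀ x y, B x y = B y x) (hB : ∀ x, (∀ y, B x y = 0) → x = 0)
    (hsat : ∀ n, (2 : ℤ) • n ∈ M → n ∈ M)
    (hdecomp : ∀ n, ∃ m : M, ∃ k : B.orthogonal M, (m : N) + k = (2 : ℤ) • n) {n : N}
    (hn : ∀ k : B.orthogonal M, B n k = 0) : n ∈ M := by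
  have hMK : ∀ (m : M) (k : B.orthogonal M), B m k = 0 := fun m k => k.2 _ m.2
  obtain ⟨m, k, hmk⟩ := hdecomp n
  have hk : (k : N) = 0 := by
    refine hB _ fun n' => ?_
    obtain ⟨m', l, hml⟩ := hdecomp n'
    have h1 : B k l = 0 := by
      have h3 : B (m + k) l = 0 := by
        rw [hmk, map_smul, LinearMap.smul_apply, hn, smul_zero]
      rwa [map_add, LinearMap.add_apply, hMK, zero_add] at h3
    have h2 : B k (m' + l) = 0 := by
      rw [map_add, h1, hsymm, hMK, zero_add]
    rw [hml, map_smul, smul_eq_mul] at h2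
    linarith
  apply hsat
  rw [← hmk, hk, add_zero]
  exact m.2

namespace IsFullGluing

variable {B : LinearMap.BilinForm ℤ N} {M : Submodule ℤ N} {ι : (Fin 2 ⊕ Fin 8 → ℤ) →ₗ[ℤ] N}

theorem apply_eq_zero (h : IsFullGluing B M ι) (x : Fin 2 ⊕ Fin 8 → ℤ) (k : B.orthogonal M) :
    B (ι x) k = 0 :=
  k.2 _ ((h.mem_iff _).2 ⟨x, rfl⟩)

theorem mem_orthogonal (h : IsFullGluing B M ι) {n : N} (hn : ∀ x, B (ι x) n = 0) :
    n ∈ B.orthogonal M := by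
  intro m hm
  obtain ⟨x, rfl⟩ := (h.mem_iff m).1 hm
  exact hn x

theorem eq_zero_of_mem_orthogonal (h : IsFullGluing B M ι) {x : Fin 2 ⊕ Fin 8 → ℤ}
    (hx : ι x ∈ B.orthogonal M) : x = 0 := by
  have h0 : ∀ y, gammaForm y x = 0 := fun y => by
    have := h.apply_eq_zero y ⟨_, hx⟩
    rw [h.form] at this
    linarith
  funext i
  obtain ⟨y, hy⟩ := exists_gammaForm_eq (LinearMap.proj i)
  exact (hy x).symm.trans (h0 y)

theorem decomp_unique (h : IsFullGluing B M ι) {x y : Fin 2 ⊕ Fin 8 → ℤ} {k l : B.orthogonal M}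
    (hxy : ι x + k = ι y + l) : x = y ∧ k = l := by
  have h1 : ι (x - y) = ((l - k : B.orthogonal M) : N) := by
    rw [map_sub, Submodule.coe_sub, sub_eq_sub_iff_add_eq_add, hxy, add_comm]
  have h2 : x - y = 0 := h.eq_zero_of_mem_orthogonal (by rw [h1]; exact (l - k).2)
  obtain rfl := sub_eq_zero.1 h2
  exact ⟨rfl, Subtype.ext (add_left_cancel hxy)⟩

theorem injective (h : IsFullGluing B M ι) : Function.Injective ι := fun x y hxy =>
  (h.decomp_unique (x := x) (y := y) (k := 0) (l := 0) (by rw [hxy])).1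

/-- `x` and `k` are glued: their sum is divisible by `2`. -/
def Glued (ι : (Fin 2 ⊕ Fin 8 → ℤ) →ₗ[ℤ] N) (x : Fin 2 ⊕ Fin 8 → ℤ) (k : N) : Prop :=
  ∃ n, ι x + k = (2 : ℤ) • n

theorem Glued.add {x y : Fin 2 ⊕ Fin 8 → ℤ} {k l : N} (hx : Glued ι x k) (hy : Glued ι y l) :
    Glued ι (x + y) (k + l) := by
  obtain ⟨n, hn⟩ := hx
  obtain ⟨m, hm⟩ := hy
  exact ⟨n + m, by rw [map_add, smul_add, ← hn, ← hm, add_add_add_comm]⟩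

theorem Glued.congr_left {x y : Fin 2 ⊕ Fin 8 → ℤ} {k : N} (hx : Glued ι x k)
    (hxy : modTwo x = modTwo y) : Glued ι y k := by
  obtain ⟨n, hn⟩ := hx
  obtain ⟨z, rfl⟩ := modTwo_eq_iff.1 hxy
  refine ⟨n - ι z, ?_⟩
  rw [smul_sub, ← hn, map_add, map_smul]
  abel

theorem glued_left_unique (h : IsFullGluing B M ι) {x y : Fin 2 ⊕ Fin 8 → ℤ} {k l k₀ : N}
    (hx : Glued ι x k) (hy : Glued ι y l) (hkl : k = l + (2 : ℤ) • k₀) : modTwo x = modTwo y := by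
  obtain ⟨n, hn⟩ := hx
  obtain ⟨m, hm⟩ := hy
  have h1 : ι (x - y) = (2 : ℤ) • (n - m - k₀) := by
    rw [smul_sub, smul_sub, ← hn, ← hm, hkl, map_sub]
    abel
  obtain ⟨z, hz⟩ := (h.mem_iff _).1 (h.saturated _ ((h.mem_iff _).2 ⟨_, h1⟩))
  rw [← hz, ← map_smul] at h1
  exact modTwo_eq_iff.2 ⟨z, by rw [← h.injective h1]; abel⟩

theorem glued_right_unique (h : IsFullGluing B M ι) {x y : Fin 2 ⊕ Fin 8 → ℤ}
    {k l : B.orthogonal M} (hx : Glued ι x k) (hy : Glued ι y l) (hxy : modTwo x = modTwo y) :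
    ∃ k₀ : B.orthogonal M, k = l + (2 : ℤ) • k₀ := by
  obtain ⟨n, hn⟩ := hx.congr_left hxy
  obtain ⟨m, hm⟩ := hy
  have h1 : ((k - l : B.orthogonal M) : N) = (2 : ℤ) • (n - m) := by
    rw [smul_sub, ← hn, ← hm, Submodule.coe_sub]
    abel
  refine ⟨⟨n - m, h.mem_orthogonal fun z => ?_⟩, Subtype.ext ?_⟩
  · have h2 := h.apply_eq_zero z (k - l)
    rw [h1, map_smul, smul_eq_mul] at h2
    linarith
  · rw [Submodule.coe_add, Submodule.coe_smul, ← h1, Submodule.coe_sub]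
    abel

theorem glued_even (h : IsFullGluing B M ι) {x : Fin 2 ⊕ Fin 8 → ℤ} {k : B.orthogonal M}
    (hx : Glued ι x k) (l : B.orthogonal M) : Even (B k l) := by
  obtain ⟨n, hn⟩ := hx
  have h1 : B (ι x + k) l = B k l := by
    rw [map_add, LinearMap.add_apply, h.apply_eq_zero, zero_add]
  rw [← h1, hn, map_smul, LinearMap.smul_apply, smul_eq_mul]
  exact even_two_mul _

/-- The vectors `k` that have a partner are exactly those with even products on the complement, a
condition that isometries preserve. -/
theorem exists_glued_apply (h : IsFullGluing B M ι)
    {φ : B.orthogonal M ≃ₗ[ℤ] B.orthogonal M}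
    (hφ : φ ∈ isometryGroup (B.restrict (B.orthogonal M)))
    {x : Fin 2 ⊕ Fin 8 → ℤ} {k : B.orthogonal M} (hx : Glued ι x k) :
    ∃ y, Glued ι y (φ k) := by
  refine h.glue_right _ fun l => ?_
  have h1 := hφ k (φ.symm l)
  rw [LinearEquiv.apply_symm_apply] at h1
  change B (φ k) l = B k _ at h1
  rw [h1]
  exact h.glued_even hx _

/-- The action on `M / 2M` induced by an isometry of the orthogonal complement. -/
theorem exists_induced_fun (h : IsFullGluing B M ι)
    {φ : B.orthogonal M ≃ₗ[ℤ] B.orthogonal M}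
    (hφ : φ ∈ isometryGroup (B.restrict (B.orthogonal M))) :
    ∃ g : (Fin 2 ⊕ Fin 8 → ZMod 2) → (Fin 2 ⊕ Fin 8 → ZMod 2),
      ∀ (x y : Fin 2 ⊕ Fin 8 → ℤ) (k : B.orthogonal M), Glued ι x k → Glued ι y (φ k) →
        g (modTwo x) = modTwo y := by
  have hex : ∀ v, ∃ (x y : Fin 2 ⊕ Fin 8 → ℤ) (k : B.orthogonal M),
      modTwo x = v ∧ Glued ι x k ∧ Glued ι y (φ k) := fun v => by
    obtain ⟨x, rfl⟩ := modTwo_surjective v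
    obtain ⟨k, hk⟩ := h.glue_left x
    obtain ⟨y, hy⟩ := h.exists_glued_apply hφ hk
    exact ⟨x, y, k, rfl, hk, hy⟩
  choose a b c h1 h2 h3 using hex
  -- Independence of the choices: vectors glued to the same class differ by twice a vector of the
  -- complement, and so do their images under `φ`.
  refine ⟨fun v => modTwo (b v), fun x y k hx hy => ?_⟩
  obtain ⟨k₀, hk₀⟩ := h.glued_right_unique (h2 (modTwo x)) hx (h1 _)
  refine h.glued_left_unique (h3 (modTwo x)) hy (k₀ := φ k₀) ?_
  rw [hk₀, map_add, map_smul]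
  rfl

theorem exists_induced_equiv (h : IsFullGluing B M ι)
    {φ : B.orthogonal M ≃ₗ[ℤ] B.orthogonal M}
    (hφ : φ ∈ isometryGroup (B.restrict (B.orthogonal M))) :
    ∃ g : (Fin 2 ⊕ Fin 8 → ZMod 2) ≃ₗ[ZMod 2] (Fin 2 ⊕ Fin 8 → ZMod 2),
      (∀ v, gammaQuadModTwo (g v) = gammaQuadModTwo v) ∧
      ∀ (x y : Fin 2 ⊕ Fin 8 → ℤ) (k : B.orthogonal M), Glued ι x k → Glued ι y (φ k) →
        g (modTwo x) = modTwo y := by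
  obtain ⟨g, hg⟩ := h.exists_induced_fun hφ
  have hφ' : φ.symm ∈ isometryGroup (B.restrict (B.orthogonal M)) :=
    (isometryGroup (B.restrict (B.orthogonal M))).inv_mem hφ
  obtain ⟨g', hg'⟩ := h.exists_induced_fun hφ'
  have hex : ∀ v, ∃ (x y : Fin 2 ⊕ Fin 8 → ℤ) (k : B.orthogonal M),
      modTwo x = v ∧ Glued ι x k ∧ Glued ι y (φ k) := fun v => by
    obtain ⟨x, rfl⟩ := modTwo_surjective v
    obtain ⟨k, hk⟩ := h.glue_left x
    obtain ⟨y, hy⟩ := h.exists_glued_apply hφ hk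
    exact ⟨x, y, k, rfl, hk, hy⟩
  have hadd : ∀ v w, g (v + w) = g v + g w := fun v w => by
    obtain ⟨x, y, k, rfl, hx, hy⟩ := hex v
    obtain ⟨x', y', k', rfl, hx', hy'⟩ := hex w
    rw [hg _ _ _ hx hy, hg _ _ _ hx' hy', ← map_add, ← map_add]
    refine hg _ _ (k + k') (hx.add hx') ?_
    rw [map_add]
    exact hy.add hy'
  have hleft : Function.LeftInverse g' g := fun v => by
    obtain ⟨x, y, k, rfl, hx, hy⟩ := hex v
    rw [hg _ _ _ hx hy]
    exact hg' _ _ (φ k) hy (by rwa [LinearEquiv.symm_apply_apply])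
  have hright : Function.RightInverse g' g := fun v => by
    obtain ⟨x, rfl⟩ := modTwo_surjective v
    obtain ⟨k, hk⟩ := h.glue_left x
    obtain ⟨y, hy⟩ := h.exists_glued_apply hφ' hk
    rw [hg' _ _ _ hk hy]
    exact hg _ _ (φ.symm k) hy (by rwa [LinearEquiv.apply_symm_apply])
  let G : (Fin 2 ⊕ Fin 8 → ZMod 2) →ₗ[ZMod 2] (Fin 2 ⊕ Fin 8 → ZMod 2) :=
    (AddMonoidHom.mk' g hadd).toZModLinearMap 2
  refine ⟨{ G with invFun := g', left_inv := hleft, right_inv := hright }, fun v => ?_, hg⟩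
  obtain ⟨x, y, k, rfl, hx, hy⟩ := hex v
  change gammaQuadModTwo (g (modTwo x)) = _
  rw [hg _ _ _ hx hy]
  obtain ⟨c, hc⟩ := gammaForm_even x
  obtain ⟨d, hd⟩ := gammaForm_even y
  rw [← two_mul] at hc hd
  -- Here the evenness of `N` enters: `B (2n) (2n)` is divisible by `8`, so `B l l` determines
  -- `gammaForm z z / 2` modulo 2.
  have hnorm : ∀ (z : Fin 2 ⊕ Fin 8 → ℤ) (l : B.orthogonal M), Glued ι z l →
      ∃ s, 2 * gammaForm z z + B l l = 8 * s := by
    rintro z l ⟨n, hn⟩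
    obtain ⟨s, hs⟩ := h.even n
    refine ⟨s, ?_⟩
    have h1 : B (ι z + l) (ι z + l) = 2 * gammaForm z z + B l l := by
      have h0 := h.apply_eq_zero z l
      have h0' := h.symm l (ι z)
      simp only [map_add, LinearMap.add_apply, h.form, h0', h0]
      ring
    rw [← h1, hn, map_smul, map_smul, LinearMap.smul_apply, smul_eq_mul, smul_eq_mul, hs]
    ring
  obtain ⟨s, hs⟩ := hnorm x k hx
  obtain ⟨t, ht⟩ := hnorm y (φ k) hy
  have hkk : B (φ k) (φ k) = B k k := hφ k k
  rw [hkk] at ht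
  rw [gammaQuadModTwo_modTwo hc, gammaQuadModTwo_modTwo hd,
    ZMod.intCast_eq_intCast_iff_dvd_sub]
  refine ⟨s - t, ?_⟩
  push_cast
  linarith

theorem exists_compatible_isometry (h : IsFullGluing B M ι)
    {φ : B.orthogonal M ≃ₗ[ℤ] B.orthogonal M}
    (hφ : φ ∈ isometryGroup (B.restrict (B.orthogonal M))) :
    ∃ f ∈ isometryGroup gammaForm, ∀ (x : Fin 2 ⊕ Fin 8 → ℤ) (k : B.orthogonal M),
      Glued ι x k → Glued ι (f x) (φ k) := by
  obtain ⟨g, hgq, hg⟩ := h.exists_induced_equiv hφ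
  obtain ⟨f, hf, hfg⟩ := exists_isometry_lift g hgq
  refine ⟨f, hf, fun x k hx => ?_⟩
  obtain ⟨y, hy⟩ := h.exists_glued_apply hφ hx
  exact hy.congr_left (by rw [hfg, hg x y k hx hy])

theorem compatible_symm (h : IsFullGluing B M ι) {f : (Fin 2 ⊕ Fin 8 → ℤ) ≃ₗ[ℤ] _}
    {φ : B.orthogonal M ≃ₗ[ℤ] B.orthogonal M}
    (hφ : φ ∈ isometryGroup (B.restrict (B.orthogonal M)))
    (hfφ : ∀ (x : Fin 2 ⊕ Fin 8 → ℤ) (k : B.orthogonal M), Glued ι x k → Glued ι (f x) (φ k))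
    (x : Fin 2 ⊕ Fin 8 → ℤ) (k : B.orthogonal M) (hx : Glued ι x k) :
    Glued ι (f.symm x) (φ.symm k) := by
  have hφ' : φ.symm ∈ isometryGroup (B.restrict (B.orthogonal M)) :=
    (isometryGroup (B.restrict (B.orthogonal M))).inv_mem hφ
  obtain ⟨y, hy⟩ := h.exists_glued_apply hφ' hx
  refine hy.congr_left ?_
  have h1 := hfφ _ _ hy
  rw [LinearEquiv.apply_symm_apply] at h1
  obtain ⟨z, hz⟩ := modTwo_eq_iff.1 (h.glued_left_unique h1 hx (k₀ := 0) (by simp))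
  refine modTwo_eq_iff.2 ⟨f.symm z, ?_⟩
  rw [← map_smul, ← map_add, ← hz, LinearEquiv.symm_apply_apply]

/-- The extension is `f ⊕ φ` on `M ⊕ K`, which contains `2N`; compatibility with the gluing makes
the image of `2n` divisible by `2`. -/
theorem exists_extension (h : IsFullGluing B M ι) {f : (Fin 2 ⊕ Fin 8 → ℤ) ≃ₗ[ℤ] _}
    {φ : B.orthogonal M ≃ₗ[ℤ] B.orthogonal M}
    (hfφ : ∀ (x : Fin 2 ⊕ Fin 8 → ℤ) (k : B.orthogonal M), Glued ι x k → Glued ι (f x) (φ k)) :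
    ∃ F : N →ₗ[ℤ] N, ∀ (n : N) (x : Fin 2 ⊕ Fin 8 → ℤ) (k : B.orthogonal M),
      ι x + k = (2 : ℤ) • n → ι (f x) + φ k = (2 : ℤ) • F n := by
  have hex : ∀ n, ∃ n' : N, ∀ (x : Fin 2 ⊕ Fin 8 → ℤ) (k : B.orthogonal M),
      ι x + k = (2 : ℤ) • n → ι (f x) + φ k = (2 : ℤ) • n' := fun n => by
    obtain ⟨x, k, hxk⟩ := h.decomp n
    obtain ⟨n', hn'⟩ := hfφ x k ⟨n, hxk⟩
    refine ⟨n', fun y l hyl => ?_⟩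
    obtain ⟨rfl, rfl⟩ := h.decomp_unique (hyl.trans hxk.symm)
    exact hn'
  choose F hF using hex
  refine ⟨(AddMonoidHom.mk' F fun n m => h.torsion _ _ ?_).toIntLinearMap, hF⟩
  obtain ⟨x, k, hxk⟩ := h.decomp n
  obtain ⟨y, l, hyl⟩ := h.decomp m
  rw [smul_add, ← hF n x k hxk, ← hF m y l hyl, ← hF (n + m) (x + y) (k + l)]
  · rw [map_add, map_add, map_add, Submodule.coe_add, add_add_add_comm]
  · rw [map_add, Submodule.coe_add, smul_add, ← hxk, ← hyl, add_add_add_comm]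

theorem exists_isometry_extension (h : IsFullGluing B M ι)
    {φ : B.orthogonal M ≃ₗ[ℤ] B.orthogonal M}
    (hφ : φ ∈ isometryGroup (B.restrict (B.orthogonal M))) :
    ∃ ψ : isometryGroup B, ∀ k : B.orthogonal M, ψ.1 k = φ k := by
  obtain ⟨f, hf, hfφ⟩ := h.exists_compatible_isometry hφ
  obtain ⟨F, hF⟩ := h.exists_extension hfφ
  obtain ⟨F', hF'⟩ := h.exists_extension (h.compatible_symm hφ hfφ)
  have h1 : F ∘ₗ F' = LinearMap.id := LinearMap.ext fun n => by
    obtain ⟨x, k, hxk⟩ := h.decomp n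
    apply h.torsion
    change (2 : ℤ) • F (F' n) = (2 : ℤ) • n
    rw [← hF _ _ _ (hF' n x k hxk), LinearEquiv.apply_symm_apply, LinearEquiv.apply_symm_apply,
      hxk]
  have h2 : F' ∘ₗ F = LinearMap.id := LinearMap.ext fun n => by
    obtain ⟨x, k, hxk⟩ := h.decomp n
    apply h.torsion
    change (2 : ℤ) • F' (F n) = (2 : ℤ) • n
    rw [← hF' _ _ _ (hF n x k hxk), LinearEquiv.symm_apply_apply, LinearEquiv.symm_apply_apply,
      hxk]
  refine ⟨⟨LinearEquiv.ofLinearMap F F' h1 h2, fun n m => ?_⟩, fun k => ?_⟩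
  · change B (F n) (F m) = B n m
    have hexp : ∀ (x y : Fin 2 ⊕ Fin 8 → ℤ) (k l : B.orthogonal M) (a b : N),
        ι x + k = (2 : ℤ) • a → ι y + l = (2 : ℤ) • b →
        2 * gammaForm x y + B k l = 4 * B a b := fun x y k l a b ha hb => by
      have h3 : B (ι x + k) (ι y + l) = 4 * B a b := by
        rw [ha, hb, map_smul, map_smul, LinearMap.smul_apply, smul_eq_mul, smul_eq_mul]
        ring
      have h4 := h.apply_eq_zero x l
      have h5 := h.symm k (ι y)
      rw [h.apply_eq_zero] at h5
      simp only [map_add, LinearMap.add_apply, h.form, h4, h5] at h3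
      linarith
    obtain ⟨x, k, hxk⟩ := h.decomp n
    obtain ⟨y, l, hyl⟩ := h.decomp m
    have h3 := hexp x y k l n m hxk hyl
    have h4 := hexp _ _ _ _ _ _ (hF n x k hxk) (hF m y l hyl)
    have h5 : B (φ k) (φ l) = B k l := hφ k l
    rw [hf x y, h5] at h4
    linarith
  · have h3 := hF (k : N) 0 ((2 : ℤ) • k) (by simp)
    rw [map_zero, map_zero, zero_add, map_smul, Submodule.coe_smul] at h3
    exact (h.torsion _ _ h3).symm

theorem mem_of_orthogonal (h : IsFullGluing B M ι) (hB : ∀ x, (∀ y, B x y = 0) → x = 0) {n : N}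
    (hn : ∀ k : B.orthogonal M, B n k = 0) : n ∈ M := by
  refine mem_of_orthogonal_orthogonal h.symm hB h.saturated (fun n => ?_) hn
  obtain ⟨x, k, hxk⟩ := h.decomp n
  exact ⟨⟨ι x, (h.mem_iff _).2 ⟨x, rfl⟩⟩, k, hxk⟩

theorem map_eq (h : IsFullGluing B M ι) (hB : ∀ x, (∀ y, B x y = 0) → x = 0)
    {φ : B.orthogonal M ≃ₗ[ℤ] B.orthogonal M} (ψ : isometryGroup B)
    (hψ : ∀ k : B.orthogonal M, ψ.1 k = φ k) : M.map ψ.1.toLinearMap = M := by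
  have hψ' : ∀ k : B.orthogonal M, ψ.1.symm k = φ.symm k := fun k => by
    rw [LinearEquiv.symm_apply_eq, hψ, LinearEquiv.apply_symm_apply]
  apply le_antisymm
  · rintro _ ⟨m, hm, rfl⟩
    refine h.mem_of_orthogonal hB fun k => ?_
    have h1 := ψ.2 m (ψ.1.symm k)
    rw [LinearEquiv.apply_symm_apply, hψ'] at h1
    exact h1.trans ((φ.symm k).2 m hm)
  · intro m hm
    refine ⟨ψ.1.symm m, h.mem_of_orthogonal hB fun k => ?_, ψ.1.apply_symm_apply m⟩
    have h1 := ψ.2 (ψ.1.symm m) k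
    rw [LinearEquiv.apply_symm_apply, hψ] at h1
    exact h1.symm.trans ((φ k).2 m hm)

/-- Two isometries that agree on the orthogonal complement of `M` agree modulo `p` on every vector
whose products with `M` are divisible by the odd number `p`. -/
theorem exists_sub_eq_smul (h : IsFullGluing B M ι) {p : ℤ} (hp : Odd p) {ψ₁ ψ₂ : N →ₗ[ℤ] N}
    (hψ : ∀ k : B.orthogonal M, ψ₁ k = ψ₂ k) {n : N} (hn : ∀ x, p ∣ B n (ι x)) :
    ∃ w, ψ₁ n - ψ₂ n = p • w := by
  obtain ⟨a, ha⟩ := exists_gammaForm_eq (B n ∘ₗ ι)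
  have hdvd : ∀ i, p ∣ a i := fun i => by
    obtain ⟨y, hy⟩ := exists_gammaForm_eq (LinearMap.proj i)
    have h1 : a i = B n (ι y) := by
      rw [← LinearMap.comp_apply, ← ha, gammaForm_symm, hy, LinearMap.proj_apply]
    rw [h1]
    exact hn y
  choose c hc using hdvd
  have hac : a = p • c := funext hc
  -- By unimodularity of `Γ`, the `M`-component of `2n` is `p • ι c`, so `2(ψ₁ n - ψ₂ n)` is a
  -- multiple of `p`; writing `p = 2t + 1` removes the factor `2`.
  have hmem : (2 : ℤ) • n - p • ι c ∈ B.orthogonal M := h.mem_orthogonal fun y => by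
    have h1 := ha y
    rw [hac, map_smul, LinearMap.smul_apply, smul_eq_mul, LinearMap.comp_apply] at h1
    rw [map_sub, map_smul, map_smul, h.symm, h.symm (ι y), h.form, ← h1, smul_eq_mul, smul_eq_mul]
    ring
  have h1 := hψ ⟨_, hmem⟩
  simp only [map_sub, map_smul] at h1
  obtain ⟨t, rfl⟩ := hp
  refine ⟨ψ₁ n - ψ₂ n - t • (ψ₁ (ι c) - ψ₂ (ι c)), h.torsion _ _ ?_⟩
  linear_combination (norm := module) (-2 * t) • h1

end IsFullGluing

end Gluing

/-! ### Consequences of `p`-elementarity: the gluing is full, and the action on the discriminant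
group. -/

section Elementary

variable {N : Type*} [AddCommGroup N] [Module.Free ℤ N] [Module.Finite ℤ N]
  {B : LinearMap.BilinForm ℤ N}

/-- A nonzero multiple of any functional is represented by a lattice vector. -/
theorem exists_det_mul_eq (hB : B.Nondegenerate) (χ : N →ₗ[ℤ] ℤ) :
    ∃ d : ℤ, d ≠ 0 ∧ ∃ n, ∀ y, B n y = d * χ y := by
  let b := Module.finBasis ℤ N
  let G := LinearMap.BilinForm.toMatrix b B
  -- Cramer's rule: the adjugate of the Gram matrix solves the system up to the factor `G.det`.
  refine ⟨G.det, (LinearMap.BilinForm.nondegenerate_iff_det_ne_zero b).1 hB,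
    ∑ i, Matrix.vecMul (fun i => χ (b i)) G.adjugate i • b i, fun y => ?_⟩
  suffices h : B (∑ i, Matrix.vecMul (fun i => χ (b i)) G.adjugate i • b i) = G.det • χ by
    rw [h]; rfl
  refine b.ext fun j => ?_
  have h : Matrix.vecMul (Matrix.vecMul (fun i => χ (b i)) G.adjugate) G j = G.det * χ (b j) := by
    rw [Matrix.vecMul_vecMul, Matrix.adjugate_mul, Matrix.vecMul_smul, Matrix.vecMul_one]
    rfl
  rw [LinearMap.smul_apply, smul_eq_mul, ← h, map_sum, LinearMap.sum_apply]
  simp [Matrix.vecMul, dotProduct, G, LinearMap.BilinForm.toMatrix_apply]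

omit [Module.Free ℤ N] [Module.Finite ℤ N] in
theorem IsElementary.exists_tmul_eq {p : ℕ} (h : IsElementary B p) {x : ℚ ⊗[ℤ] N}
    (hx : x ∈ dual B) : ∃ n : N, (1 : ℚ) ⊗ₜ[ℤ] n = p • x := by
  have h1 := h (Submodule.Quotient.mk ⟨x, hx⟩)
  rw [← Submodule.Quotient.mk_smul, Submodule.Quotient.mk_eq_zero] at h1
  exact h1

/-- In a `p`-elementary lattice, `p` times any functional is represented by a lattice vector. -/
theorem IsElementary.exists_eq_mul {p : ℕ} (h : IsElementary B p) (hB : B.Nondegenerate)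
    (χ : N →ₗ[ℤ] ℤ) : ∃ n, ∀ y, B n y = p * χ y := by
  obtain ⟨d, hd, m, hm⟩ := exists_det_mul_eq hB χ
  have hd' : (d : ℚ) ≠ 0 := Int.cast_ne_zero.2 hd
  have hform : ∀ y, rationalForm B ((d : ℚ)⁻¹ ⊗ₜ[ℤ] m) ((1 : ℚ) ⊗ₜ[ℤ] y) = χ y := fun y => by
    rw [LinearMap.BilinForm.baseChange_tmul, hm]
    simp
    field_simp
  obtain ⟨n, hn⟩ := h.exists_tmul_eq ((mem_dual_iff B _).2 fun y => ⟨χ y, (hform y).symm⟩)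
  refine ⟨n, fun y => ?_⟩
  have h1 : rationalForm B ((1 : ℚ) ⊗ₜ[ℤ] n) ((1 : ℚ) ⊗ₜ[ℤ] y) = p * χ y := by
    rw [hn, map_nsmul, LinearMap.smul_apply, hform, nsmul_eq_mul]
  rw [LinearMap.BilinForm.baseChange_tmul] at h1
  have h2 : ((B n y : ℤ) : ℚ) = ((p * χ y : ℤ) : ℚ) := by
    push_cast
    simpa using h1
  exact_mod_cast h2

omit [Module.Free ℤ N] [Module.Finite ℤ N] in
theorem exists_retraction {W : Submodule ℤ N} [Module.Free ℤ (N ⧸ W)] :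
    ∃ ρ : N →ₗ[ℤ] W, ∀ w : W, ρ w = w := by
  obtain ⟨s, hs⟩ := W.mkQ.exists_rightInverse_of_surjective W.range_mkQ
  refine ⟨(LinearMap.id - s ∘ₗ W.mkQ).codRestrict W fun n => ?_, fun w => Subtype.ext ?_⟩
  · simp [(Submodule.Quotient.mk_eq_zero W).2 w.2]
  · rw [← Submodule.Quotient.mk_eq_zero, ← Submodule.mkQ_apply]
    have h := LinearMap.congr_fun hs (W.mkQ n)
    simp only [LinearMap.comp_apply, LinearMap.id_apply] at h
    simp only [LinearMap.sub_apply, LinearMap.comp_apply, LinearMap.id_apply, map_sub, h, sub_self]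

omit [Module.Free ℤ N] in
/-- The orthogonal complement of a sublattice is primitive. -/
theorem free_quotient_orthogonal (M : Submodule ℤ N) :
    Module.Free ℤ (N ⧸ B.orthogonal M) := by
  let T : N →ₗ[ℤ] Module.Dual ℤ M := M.subtype.dualMap ∘ₗ B.flip
  have h : B.orthogonal M = LinearMap.ker T := by
    ext n
    rw [LinearMap.mem_ker, LinearMap.ext_iff]
    exact ⟨fun hn m => hn m m.2, fun hn m hm => hn ⟨m, hm⟩⟩
  rw [h]
  exact Module.Free.of_equiv T.quotKerEquivRange.symm

/-- A primitive sublattice is a direct summand, so its functionals extend to `N`. -/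
theorem IsElementary.exists_eq_mul_of_primitive {p : ℕ} (h : IsElementary B p)
    (hB : B.Nondegenerate) {W : Submodule ℤ N} [Module.Free ℤ (N ⧸ W)] (χ : W →ₗ[ℤ] ℤ) :
    ∃ n, ∀ w : W, B n w = p * χ w := by
  obtain ⟨ρ, hρ⟩ := exists_retraction (W := W)
  obtain ⟨n, hn⟩ := h.exists_eq_mul hB (χ ∘ₗ ρ)
  exact ⟨n, fun w => by rw [hn, LinearMap.comp_apply, hρ]⟩

/-- Divide a functional with even values by `2`. -/
theorem exists_half {W : Type*} [AddCommGroup W] (χ : W →ₗ[ℤ] ℤ) (h : ∀ w, Even (χ w)) :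
    ∃ χ' : W →ₗ[ℤ] ℤ, ∀ w, χ w = 2 * χ' w := by
  choose f hf using h
  refine ⟨(AddMonoidHom.mk' f fun a b => ?_).toIntLinearMap, fun w => (hf w).trans (two_mul _).symm⟩
  have h1 := hf (a + b)
  rw [map_add, hf a, hf b] at h1
  omega

theorem isFullGluing_of_mem_enriquesSublattices {p : ℕ} (hp : Odd p) (hE : IsEvenLattice B)
    (h : IsElementary B p) {M : Submodule ℤ N} [Module.Free ℤ (N ⧸ M)]
    (e : (Fin 2 ⊕ Fin 8 → ℤ) ≃ₗ[ℤ] M) (he : ∀ x y, B (e x) (e y) = gammaTwo x y) :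
    IsFullGluing B M (M.subtype ∘ₗ e.toLinearMap) := by
  have hform : ∀ x y, B (e x) (e y) = 2 * gammaForm x y := fun x y => by
    rw [he]; rfl
  have hsymm := hE.symm
  have htors : ∀ x y : N, (2 : ℤ) • x = (2 : ℤ) • y → x = y := fun x y hxy =>
    smul_right_injective N (two_ne_zero (α := ℤ)) hxy
  have hsat : ∀ n, (2 : ℤ) • n ∈ M → n ∈ M := fun n hn => by
    rw [← Submodule.Quotient.mk_eq_zero] at hn ⊢
    rw [Submodule.Quotient.mk_smul] at hn
    exact (smul_eq_zero.1 hn).resolve_left two_ne_zero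
  have hortho : ∀ n, (∀ x, B (e x) n = 0) → n ∈ B.orthogonal M := fun n hn m hm => by
    have := hn (e.symm ⟨m, hm⟩)
    rwa [LinearEquiv.apply_symm_apply] at this
  have hdecomp : ∀ n, ∃ x, ∃ k : B.orthogonal M, (e x : N) + k = (2 : ℤ) • n := fun n => by
    obtain ⟨x, hx⟩ := exists_gammaForm_eq (B n ∘ₗ M.subtype ∘ₗ e.toLinearMap)
    refine ⟨x, ⟨(2 : ℤ) • n - e x, hortho _ fun y => ?_⟩, by simp⟩
    have h1 : gammaForm x y = B n (e y) := hx y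
    rw [map_sub, map_smul, hsymm (e y), hsymm (e y), hform, h1, smul_eq_mul, sub_self]
  obtain ⟨t, ht⟩ := hp
  have ht' : (p : ℤ) = 2 * t + 1 := by exact_mod_cast ht
  refine ⟨hsymm, hE.even, fun m => ⟨fun hm => ⟨e.symm ⟨m, hm⟩, by simp⟩, ?_⟩, hform, htors, hsat,
    hdecomp, fun x => ?_, fun k hk => ?_⟩
  · rintro ⟨x, rfl⟩
    exact (e x).2
  · obtain ⟨n, hn⟩ := h.exists_eq_mul_of_primitive hE.nondegenerate
      (gammaForm x ∘ₗ e.symm.toLinearMap)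
    have hn' : ∀ y, B n (e y) = p * gammaForm x y := fun y => by
      rw [hn]; simp
    -- On `M`, `n` pairs like `(p/2) • e x`, so `2n - p • e x` lies in the complement; as `p - 1 =
    -- 2t`, adding `e x` gives a multiple of `2`.
    refine ⟨⟨(2 : ℤ) • n - (p : ℤ) • (e x : N), hortho _ fun y => ?_⟩, n - (t : ℤ) • (e x : N), ?_⟩
    · rw [map_sub, map_smul, map_smul, hsymm (e y), hsymm (e y), hform, hn', smul_eq_mul,
        smul_eq_mul]
      ring
    · change (e x : N) + _ = _
      simp only [ht']
      module
  · obtain ⟨χ, hχ⟩ := exists_half (B k ∘ₗ (B.orthogonal M).subtype) hk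
    have := free_quotient_orthogonal (B := B) M
    obtain ⟨n, hn⟩ := h.exists_eq_mul_of_primitive hE.nondegenerate χ
    -- The mirror argument: `n` pairs with the complement like `(p/2) • k`, so this difference lies
    -- in `M`.
    have hmem : (2 : ℤ) • n - (p : ℤ) • (k : N) ∈ M := by
      refine mem_of_orthogonal_orthogonal hsymm hE.nondegenerate.1 hsat (fun n => ?_) fun l => ?_
      · obtain ⟨x, l, hxl⟩ := hdecomp n
        exact ⟨e x, l, hxl⟩
      · have h1 : B k l = 2 * χ l := hχ l
        rw [map_sub, map_smul, map_smul, LinearMap.sub_apply, LinearMap.smul_apply,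
          LinearMap.smul_apply, hn, h1, smul_eq_mul, smul_eq_mul]
        ring
    refine ⟨e.symm ⟨_, hmem⟩, n - (t : ℤ) • (k : N), ?_⟩
    simp only [LinearMap.comp_apply, LinearEquiv.coe_coe, LinearEquiv.apply_symm_apply,
      Submodule.subtype_apply, ht']
    module

/-- Two isometries that agree on the orthogonal complement of `M` act in the same way on the
discriminant group. -/
theorem IsFullGluing.discriminantRepresentation_eq {p : ℕ} (hp : Odd p) (hE : IsEvenLattice B)
    (h : IsElementary B p) {M : Submodule ℤ N} {ι : (Fin 2 ⊕ Fin 8 → ℤ) →ₗ[ℤ] N}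
    (hι : IsFullGluing B M ι) {ψ₁ ψ₂ : isometryGroup B}
    (hψ : ∀ k : B.orthogonal M, ψ₁.1 k = ψ₂.1 k) :
    discriminantRepresentation hE ψ₁ = discriminantRepresentation hE ψ₂ := by
  refine Subtype.ext (LinearEquiv.toLinearMap_injective
    (Submodule.linearMap_qext _ (LinearMap.ext fun x => ?_)))
  refine (Submodule.Quotient.eq _).2 ?_
  obtain ⟨n, hn⟩ := h.exists_tmul_eq x.2
  have hp' : Odd (p : ℤ) := by exact_mod_cast hp
  have hp0 : (p : ℚ) ≠ 0 := Nat.cast_ne_zero.2 hp.pos.ne'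
  -- With `n = p • x` and `x` in the dual lattice, the products of `n` with `M` are divisible by
  -- `p`; dividing `ψ₁ n - ψ₂ n = p • w` by `p` shows that the two images of `x` differ by `w ∈ N`.
  obtain ⟨w, hw⟩ := hι.exists_sub_eq_smul hp' (ψ₁ := ψ₁.1.toLinearMap) (ψ₂ := ψ₂.1.toLinearMap)
    hψ (n := n) fun y => by
      obtain ⟨m, hm⟩ := (mem_dual_iff B _).1 x.2 (ι y)
      refine ⟨m, ?_⟩
      have h1 : rationalForm B ((1 : ℚ) ⊗ₜ[ℤ] n) ((1 : ℚ) ⊗ₜ[ℤ] ι y) = p * m := by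
        rw [hn, map_nsmul, LinearMap.smul_apply, ← hm, nsmul_eq_mul]
      rw [LinearMap.BilinForm.baseChange_tmul] at h1
      have h2 : ((B n (ι y) : ℤ) : ℚ) = ((p * m : ℤ) : ℚ) := by
        push_cast
        simpa using h1
      exact_mod_cast h2
  refine ⟨w, ?_⟩
  change (1 : ℚ) ⊗ₜ[ℤ] w = ψ₁.1.lTensor ℚ (x : ℚ ⊗[ℤ] N) - ψ₂.1.lTensor ℚ (x : ℚ ⊗[ℤ] N)
  have h1 : (p : ℤ) • ((1 : ℚ) ⊗ₜ[ℤ] w) =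
      (p : ℤ) • (ψ₁.1.lTensor ℚ (x : ℚ ⊗[ℤ] N) - ψ₂.1.lTensor ℚ (x : ℚ ⊗[ℤ] N)) := by
    rw [← TensorProduct.tmul_smul, ← hw, smul_sub, ← map_zsmul, ← map_zsmul, natCast_zsmul, ← hn,
      LinearEquiv.lTensor_tmul, LinearEquiv.lTensor_tmul, TensorProduct.tmul_sub]
    rfl
  have hinj : Function.Injective fun z : ℚ ⊗[ℤ] N => (p : ℚ) • z := smul_right_injective _ hp0
  refine hinj ?_
  simpa only [Nat.cast_smul_eq_nsmul, natCast_zsmul] using h1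

end Elementary

end K3Lattice

end

/-! ### The proposition. -/

theorem mainTheorem12 {p : ℕ} (hp : p.Prime) (hp3 : 3 ≤ p)
    {N : Type*} [AddCommGroup N] [Module.Free ℤ N] [Module.Finite ℤ N]
    (B : LinearMap.BilinForm ℤ N) (hN : K3Lattice.IsSupersingularK3Lattice B p)
    (M : Submodule ℤ N) (hM : M ∈ K3Lattice.enriquesSublattices B)
    (ψ' : B.orthogonal M ≃ₗ[ℤ] B.orthogonal M)
    (hψ' : ψ' ∈ K3Lattice.isometryGroup (B.restrict (B.orthogonal M))) :
    (∃ ψ : K3Lattice.isometryGroup B, ∀ x : B.orthogonal M, ψ.1 x = ψ' x) ∧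
    (∀ ψ : K3Lattice.isometryGroup B, (∀ x : B.orthogonal M, ψ.1 x = ψ' x) →
      M.map ψ.1.toLinearMap = M) ∧
    (∀ ψ₁ ψ₂ : K3Lattice.isometryGroup B,
      (∀ x : B.orthogonal M, ψ₁.1 x = ψ' x) → (∀ x : B.orthogonal M, ψ₂.1 x = ψ' x) →
      K3Lattice.discriminantRepresentation hN.isEvenLattice ψ₁ =
        K3Lattice.discriminantRepresentation hN.isEvenLattice ψ₂) := by
  obtain ⟨hfree, ⟨e, he⟩, -⟩ := hM
  have hodd : Odd p := hp.odd_of_ne_two (by omega)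
  have h := K3Lattice.isFullGluing_of_mem_enriquesSublattices hodd hN.isEvenLattice hN.elementary
    e he
  refine ⟨h.exists_isometry_extension hψ', fun ψ hψ => ?_, fun ψ₁ ψ₂ h₁ h₂ => ?_⟩
  · exact h.map_eq hN.isEvenLattice.nondegenerate.1 ψ hψ
  · exact h.discriminantRepresentation_eq hodd hN.isEvenLattice hN.elementary
      fun k => (h₁ k).trans (h₂ k).symm
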